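/- Let $A$ be a finite alphabet and let $A^*$ be the free monoid of finite words over $A$. A substitution on $A$ is a map $\xi : A \to A^*$; it extends uniquely to a monoid endomorphism of $A^*$, and $\xi^s : A \to A^*$ denotes the substitution that sends each letter to its image under the $s$-th iterate of this endomorphism. The substitution $\xi$ is called expanding if there is a $k \ge 1$ such that $|\xi^k(a)| \ge 2$ for every $a \in A$, where $|u|$ denotes the length of a word $u$. For words $w, u \in A^*$ let $|u|_w$ denote the number of (possibly overlapping) occurrences of $w$ as a factor of $u$. Let $\xi$ be an expanding substitution on a finite alphabet $A$. Then there exists an integer $s \ge 1$ such that the power $\zeta = \xi^s$ has the following property: for every non-empty word $w \in A^*$ and every letter $a \in A$ the limit $$\lim_{t \to \infty} \frac{|\zeta^t(a)|_w}{|\zeta^t(a)|}$$ exists (in $\mathbb{R}$). -/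

import Mathlib

open Filter Topology

namespace Substitution

/-- The monoid endomorphism of the free monoid `A*` that extends a substitution `ξ : A → A*`. -/
def extend {A : Type*} (ξ : A → FreeMonoid A) : Monoid.End (FreeMonoid A) :=
  FreeMonoid.lift ξ

/-- The power `ξ^s` of a substitution, again as a substitution: `a ↦ ξ^s(a)`, where the `s`-th
iterate is that of the endomorphism of `A*` defined by `ξ`. -/
def power {A : Type*} (ξ : A → FreeMonoid A) (s : ℕ) : A → FreeMonoid A :=
  fun a => (extend ξ ^ s) (FreeMonoid.of a)

/-- A substitution is expanding if for some `k ≥ 1` all words `ξ^k(a)` have length at least `2`. -/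
def IsExpanding {A : Type*} (ξ : A → FreeMonoid A) : Prop :=
  ∃ k : ℕ, 1 ≤ k ∧ ∀ a : A, 2 ≤ (power ξ k a).length

/-- The number `|u|_w` of (possibly overlapping) occurrences of `w` as a factor of `u`: the number
of positions in `u` at which the remaining suffix of `u` starts with `w`. -/
def occurrences {A : Type*} [DecidableEq A] (w u : FreeMonoid A) : ℕ :=
  u.toList.tails.countP (fun v => decide (w.toList <+: v))

end Substitution

/-! Let `M` be the incidence matrix of `ξ`. Periodicity may keep the entries of `M ^ t` from having
a single asymptotic, but some power `P = M ^ s` has an idempotent zero pattern. Positivity of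
entries of `P` is then a transitive relation, so every class of mutually related indices carries an
entrywise positive block, and any other index has only strictly lower successors. Positive blocks
grow like `c * ρ ^ t` by Perron–Frobenius. A class satisfies an affine recurrence forced by lower
classes, and convolution preserves regular growth (`HasRegularGrowth.conv`), so induction along the
classes gives regular growth of all entries of `P ^ t`.

For `ζ = ξ ^ s`, the word `ζ^(t+m)(a)` is a concatenation of blocks `ζ^m(b)`, one per letter of
`ζ^t(a)`. Its length and the number of occurrences of `w` inside blocks are nonnegative combinations
of letter counts of `ζ^t(a)`, so their ratio converges in `t`. Occurrences not contained in a block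
number at most `|w|` per block, a negligible proportion once all blocks are long. The frequencies
are thus uniformly close to convergent sequences, hence Cauchy. -/

/-! ### Sequences of regular growth -/

/-- A real sequence has regular growth if it vanishes eventually or is asymptotic to
`c * lam ^ t * t ^ k` for some `c, lam > 0` and `k : ℕ`. -/
def HasRegularGrowth (x : ℕ → ℝ) : Prop :=
  (∀ᶠ t in atTop, x t = 0) ∨ ∃ (c lam : ℝ) (k : ℕ), 0 < c ∧ 0 < lam ∧
    Tendsto (fun t : ℕ => x t / (lam ^ t * ((t : ℝ) + 1) ^ k)) atTop (𝓝 c)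

theorem tendsto_natCast_add_one_atTop : Tendsto (fun t : ℕ => (t : ℝ) + 1) atTop atTop :=
  tendsto_atTop_add_const_right _ _ tendsto_natCast_atTop_atTop

theorem tendsto_pow_mul_succ_pow_zero {r : ℝ} (h0 : 0 < r) (h1 : r < 1) (k : ℕ) :
    Tendsto (fun t : ℕ => r ^ t * ((t : ℝ) + 1) ^ k) atTop (𝓝 0) := by
  have h := (tendsto_pow_const_mul_const_pow_of_abs_lt_one k
    (by rwa [abs_of_pos h0] : |r| < 1))
  have h2 := ((tendsto_add_atTop_iff_nat 1).2 h).const_mul r⁻¹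
  rw [mul_zero] at h2
  refine h2.congr fun t => ?_
  push_cast
  field_simp
  ring

/-- Any two scales `lam ^ t * t ^ k` are equal or comparable. -/
theorem scale_trichotomy {lam mu : ℝ} (hl : 0 < lam) (hm : 0 < mu) (k l : ℕ) :
    (lam = mu ∧ k = l) ∨
    Tendsto (fun t : ℕ => (lam ^ t * ((t : ℝ) + 1) ^ k) / (mu ^ t * ((t : ℝ) + 1) ^ l))
      atTop (𝓝 0) ∨
    Tendsto (fun t : ℕ => (mu ^ t * ((t : ℝ) + 1) ^ l) / (lam ^ t * ((t : ℝ) + 1) ^ k))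
      atTop (𝓝 0) := by
  have key : ∀ {a b : ℝ} (_ : 0 < a) (_ : 0 < b) (p q : ℕ), (a < b ∨ (a = b ∧ p < q)) →
      Tendsto (fun t : ℕ => (a ^ t * ((t : ℝ) + 1) ^ p) / (b ^ t * ((t : ℝ) + 1) ^ q))
        atTop (𝓝 0) := by
    intro a b ha hb p q h
    rcases h with h | ⟨rfl, h⟩
    · refine squeeze_zero (fun t => by positivity) (fun t => ?_)
        (tendsto_pow_mul_succ_pow_zero (div_pos ha hb) ((div_lt_one hb).2 h) p)
      rw [div_pow, div_mul_eq_mul_div]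
      apply div_le_div_of_nonneg_left (by positivity) (by positivity)
      exact le_mul_of_one_le_right (by positivity) (one_le_pow₀ (by linarith [t.cast_nonneg (α := ℝ)]))
    · have := (tendsto_pow_div_pow_atTop_zero (𝕜 := ℝ) h).comp tendsto_natCast_add_one_atTop
      refine this.congr fun t => ?_
      simp only [Function.comp]
      rw [mul_div_mul_left _ _ (by positivity)]
  rcases lt_trichotomy lam mu with h | h | h
  · exact Or.inr (Or.inl (key hl hm k l (Or.inl h)))
  · rcases lt_trichotomy k l with h' | h' | h'
    · exact Or.inr (Or.inl (key hl hm k l (Or.inr ⟨h, h'⟩)))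
    · exact Or.inl ⟨h, h'⟩
    · exact Or.inr (Or.inr (key hm hl l k (Or.inr ⟨h.symm, h'⟩)))
  · exact Or.inr (Or.inr (key hm hl l k (Or.inl h)))

theorem tendsto_add_div_of_scale {x y g h : ℕ → ℝ} {c d e : ℝ} (hg : ∀ t, 0 < g t)
    (hx : Tendsto (fun t => x t / g t) atTop (𝓝 c))
    (hy : Tendsto (fun t => y t / h t) atTop (𝓝 d))
    (hgh : Tendsto (fun t => g t / h t) atTop (𝓝 e)) :
    Tendsto (fun t => (x t + y t) / h t) atTop (𝓝 (c * e + d)) := by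
  refine ((hx.mul hgh).add hy).congr fun t => ?_
  have := (hg t).ne'
  rw [div_mul_div_cancel₀ this, add_div]

namespace HasRegularGrowth

theorem zero : HasRegularGrowth fun _ => 0 := Or.inl (by simp)

theorem congr {x y : ℕ → ℝ} (hx : HasRegularGrowth x) (h : x =ᶠ[atTop] y) :
    HasRegularGrowth y := by
  rcases hx with hx | ⟨c, l, k, hc, hl, hx⟩
  · exact Or.inl (by filter_upwards [hx, h] with t h1 h2; rw [← h2, h1])
  · exact Or.inr ⟨c, l, k, hc, hl, hx.congr' (by filter_upwards [h] with t h2; rw [h2])⟩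

/-- Leading constants are positive, so equal scales cannot cancel; otherwise the larger scale wins.
-/
theorem add {x y : ℕ → ℝ} (hx : HasRegularGrowth x) (hy : HasRegularGrowth y) :
    HasRegularGrowth fun t => x t + y t := by
  rcases hx with hx' | ⟨c, l, k, hc, hl, hx'⟩
  · exact hy.congr (by filter_upwards [hx'] with t h; rw [h, zero_add])
  rcases hy with hy' | ⟨d, m, n, hd, hm, hy'⟩
  · exact congr (Or.inr ⟨c, l, k, hc, hl, hx'⟩)
      (by filter_upwards [hy'] with t h; rw [h, add_zero])
  rcases scale_trichotomy hl hm k n with ⟨rfl, rfl⟩ | h | h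
  · exact Or.inr ⟨c + d, l, k, by positivity, hl,
      (hx'.add hy').congr fun t => by rw [add_div]⟩
  · have := tendsto_add_div_of_scale (fun t => by positivity) hx' hy' h
    exact Or.inr ⟨d, m, n, hd, hm, by simpa using this⟩
  · have := tendsto_add_div_of_scale (fun t => by positivity) hy' hx' h
    exact Or.inr ⟨c, l, k, hc, hl, by simpa [add_comm] using this⟩

theorem const_mul {x : ℕ → ℝ} (hx : HasRegularGrowth x) {a : ℝ} (ha : 0 ≤ a) :
    HasRegularGrowth fun t => a * x t := by
  rcases ha.eq_or_lt with rfl | ha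
  · simpa using zero
  rcases hx with hx | ⟨c, l, k, hc, hl, hx⟩
  · exact Or.inl (by filter_upwards [hx] with t h; rw [h, mul_zero])
  · exact Or.inr ⟨a * c, l, k, by positivity, hl,
      (hx.const_mul a).congr fun t => by rw [mul_div_assoc]⟩

theorem sum {ι : Type*} (s : Finset ι) {x : ι → ℕ → ℝ} (h : ∀ i ∈ s, HasRegularGrowth (x i)) :
    HasRegularGrowth fun t => ∑ i ∈ s, x i t := by
  classical
  induction s using Finset.induction_on with
  | empty => simpa using zero
  | insert i s hi ih =>
    simp only [Finset.sum_insert hi]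
    exact (h i (by simp)).add (ih fun j hj => h j (by simp [hj]))

theorem of_shift {x : ℕ → ℝ} (hx : HasRegularGrowth fun t => x (t + 1)) :
    HasRegularGrowth x := by
  rcases hx with hx | ⟨c, l, k, hc, hl, hx⟩
  · refine Or.inl ?_
    rw [← map_add_atTop_eq_nat 1]
    exact hx
  · refine Or.inr ⟨c * l⁻¹ * (1 - 0) ^ k, l, k, by simp; positivity, hl, ?_⟩
    rw [← tendsto_add_atTop_iff_nat 1]
    have h1 : Tendsto (fun t : ℕ => (1 : ℝ) - ((t : ℝ) + 1 + 1)⁻¹) atTop (𝓝 (1 - 0)) :=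
      tendsto_const_nhds.sub (tendsto_inv_atTop_zero.comp
        (tendsto_atTop_add_const_right _ _ tendsto_natCast_add_one_atTop))
    refine ((hx.mul_const l⁻¹).mul (h1.pow k)).congr fun t => ?_
    have h2 : (1 : ℝ) - ((t : ℝ) + 1 + 1)⁻¹ = (t + 1) / (t + 1 + 1) := by
      field_simp; ring
    rw [h2, div_pow]
    push_cast
    field_simp
    ring

theorem mul_pow {x : ℕ → ℝ} (hx : HasRegularGrowth x) {r : ℝ} (hr : 0 < r) :
    HasRegularGrowth fun t => x t * r ^ t := by
  rcases hx with hx | ⟨c, l, k, hc, hl, hx⟩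
  · exact Or.inl (by filter_upwards [hx] with t h; rw [h, zero_mul])
  · refine Or.inr ⟨c, l * r, k, hc, by positivity, hx.congr fun t => ?_⟩
    rw [_root_.mul_pow]
    field_simp

/-- The ratio of two dominated sequences of regular growth converges. -/
theorem exists_tendsto_div {x y : ℕ → ℝ} (hx : HasRegularGrowth x) (hy : HasRegularGrowth y)
    (hxy : ∀ t, x t ≤ y t) :
    ∃ f : ℝ, Tendsto (fun t => x t / y t) atTop (𝓝 f) := by
  rcases hx with hx | ⟨c, l, k, hc, hl, hx⟩
  · refine ⟨0, tendsto_const_nhds.congr' ?_⟩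
    filter_upwards [hx] with t h
    rw [h, zero_div]
  rcases hy with hy | ⟨d, m, n, hd, hm, hy⟩
  -- Here the denominator vanishes eventually, and division by zero returns `0`.
  · refine ⟨0, tendsto_const_nhds.congr' ?_⟩
    filter_upwards [hy] with t h
    rw [h, div_zero]
  have main : ∀ e : ℝ, Tendsto (fun t : ℕ => (l ^ t * ((t : ℝ) + 1) ^ k) /
      (m ^ t * ((t : ℝ) + 1) ^ n)) atTop (𝓝 e) →
      ∃ f : ℝ, Tendsto (fun t => x t / y t) atTop (𝓝 f) := fun e he => by
    refine ⟨_, ((hx.mul he).div hy hd.ne').congr fun t => ?_⟩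
    have h1 : l ^ t * ((t : ℝ) + 1) ^ k ≠ 0 := by positivity
    have h2 : m ^ t * ((t : ℝ) + 1) ^ n ≠ 0 := by positivity
    simp only [Pi.div_apply]
    rw [div_mul_div_cancel₀ h1, div_div_div_cancel_right₀ h2]
  rcases scale_trichotomy hl hm k n with ⟨rfl, rfl⟩ | h | h
  · refine main 1 (tendsto_const_nhds.congr fun t => ?_)
    rw [div_self (by positivity)]
  · exact main 0 h
  -- If `y` had the smaller scale, `x ≤ y` would force the positive limit `c` to be at most `0`.
  · exfalso
    have h3 : Tendsto (fun t : ℕ => y t / (l ^ t * ((t : ℝ) + 1) ^ k)) atTop (𝓝 (d * 0)) := by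
      refine (hy.mul h).congr fun t => ?_
      rw [div_mul_div_cancel₀ (by positivity)]
    have := le_of_tendsto_of_tendsto' hx h3 fun t => by
      have := hxy t
      gcongr
    linarith

end HasRegularGrowth

/-! ### Convolutions of sequences -/

/-- Tannery's theorem for finite sums of growing length. -/
theorem tendsto_sum_range_of_dominated {a : ℕ → ℝ} {w : ℕ → ℕ → ℝ} {c C : ℝ}
    (ha : Summable a) (ha0 : ∀ i, 0 ≤ a i) (hw : ∀ i, Tendsto (fun t => w t i) atTop (𝓝 c))
    (hC : ∀ t, ∀ i ≤ t, |w t i| ≤ C) :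
    Tendsto (fun t => ∑ i ∈ Finset.range (t + 1), a i * w t i) atTop (𝓝 ((∑' i, a i) * c)) := by
  have hC0 : 0 ≤ C := (abs_nonneg _).trans (hC 0 0 le_rfl)
  have := tendsto_tsum_of_dominated_convergence (𝓕 := atTop)
    (f := fun t i => if i ∈ Finset.range (t + 1) then a i * w t i else 0)
    (g := fun i => a i * c) (bound := fun i => a i * C) (ha.mul_right C) ?_ ?_
  · rw [tsum_mul_right] at this
    refine this.congr fun t => ?_
    rw [tsum_eq_sum (s := Finset.range (t + 1)) fun i hi => if_neg hi]
    exact Finset.sum_congr rfl fun i hi => if_pos hi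
  · intro i
    refine ((hw i).const_mul (a i)).congr' ?_
    filter_upwards [eventually_ge_atTop i] with t ht
    rw [if_pos (by simp; omega)]
  · refine Eventually.of_forall fun t i => ?_
    split_ifs with h
    · rw [Real.norm_eq_abs, abs_mul, abs_of_nonneg (ha0 i)]
      exact mul_le_mul_of_nonneg_left (hC t i (by simp at h; omega)) (ha0 i)
    · simpa using mul_nonneg (ha0 i) hC0

theorem exists_abs_le_of_tendsto {x : ℕ → ℝ} {c : ℝ} (h : Tendsto x atTop (𝓝 c)) :
    ∃ C, ∀ t, |x t| ≤ C := by
  obtain ⟨C, hC⟩ := isBounded_iff_forall_norm_le.1 (Metric.isBounded_range_of_tendsto x h)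
  exact ⟨C, fun t => hC _ ⟨t, rfl⟩⟩

theorem tendsto_choose_div_pow (k : ℕ) :
    Tendsto (fun t : ℕ => ((t + k).choose k : ℝ) / ((t : ℝ) + 1) ^ k) atTop
      (𝓝 (1 / (k.factorial : ℝ))) := by
  induction k with
  | zero => simp
  | succ k ih =>
    have h1 : Tendsto (fun t : ℕ => (1 : ℝ) + k * ((t : ℝ) + 1)⁻¹) atTop (𝓝 (1 + k * 0)) :=
      tendsto_const_nhds.add ((tendsto_inv_atTop_zero.comp
        tendsto_natCast_add_one_atTop).const_mul _)
    have h2 := (ih.mul h1).mul_const ((k : ℝ) + 1)⁻¹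
    have e : 1 / (k.factorial : ℝ) * (1 + k * 0) * ((k : ℝ) + 1)⁻¹ =
        1 / ((k + 1).factorial : ℝ) := by
      rw [Nat.factorial_succ]; push_cast; field_simp; ring
    rw [e] at h2
    refine h2.congr fun t => ?_
    have h3 : (((t + k + 1) * (t + k).choose k : ℕ) : ℝ) =
        (((t + k + 1).choose (k + 1) * (k + 1) : ℕ) : ℝ) := by
      rw [Nat.add_one_mul_choose_eq]
    push_cast at h3
    rw [← add_assoc t k 1]
    have h4 : ((t + k + 1).choose (k + 1) : ℝ) = (t + k + 1) * (t + k).choose k / (k + 1) := by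
      rw [h3]; field_simp
    rw [h4]
    field_simp
    ring

theorem sum_range_add_choose (k t : ℕ) :
    ∑ j ∈ Finset.range (t + 1), (j + k).choose k = (t + (k + 1)).choose (k + 1) := by
  induction t with
  | zero => simp
  | succ t ih =>
    rw [Finset.sum_range_succ, ih]
    have : t + 1 + (k + 1) = (t + (k + 1)) + 1 := by ring
    rw [this, Nat.choose_succ_succ, add_comm]
    congr 2
    ring

/-- Weighted Cesàro means of a null sequence tend to zero. -/
theorem tendsto_sum_mul_div_pow_zero {e : ℕ → ℝ} {u : ℕ → ℕ → ℝ} {C : ℝ} (k : ℕ)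
    (he : Tendsto e atTop (𝓝 0))
    (hu : ∀ t, ∀ i ≤ t, |u t i| ≤ C * ((t : ℝ) + 1) ^ k) :
    Tendsto (fun t : ℕ => (∑ i ∈ Finset.range (t + 1), e i * u t i) / ((t : ℝ) + 1) ^ (k + 1))
      atTop (𝓝 0) := by
  have h1 : Tendsto (fun i => |e i|) atTop (𝓝 0) := by simpa using he.abs
  have h2 := ((tendsto_add_atTop_iff_nat 1).2 h1.cesaro).const_mul C
  rw [mul_zero] at h2
  refine squeeze_zero_norm (fun t => ?_) h2
  rw [norm_div, Real.norm_eq_abs, Real.norm_of_nonneg (by positivity), div_le_iff₀ (by positivity)]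
  calc |∑ i ∈ Finset.range (t + 1), e i * u t i|
      ≤ ∑ i ∈ Finset.range (t + 1), |e i * u t i| := Finset.abs_sum_le_sum_abs _ _
    _ ≤ ∑ i ∈ Finset.range (t + 1), |e i| * (C * ((t : ℝ) + 1) ^ k) := by
        refine Finset.sum_le_sum fun i hi => ?_
        rw [abs_mul]
        exact mul_le_mul_of_nonneg_left (hu t i (by simp at hi; omega)) (abs_nonneg _)
    _ = _ := by
        rw [← Finset.sum_mul]
        push_cast
        field_simp
        ring

/-- The model sequence `(t + k).choose k` has exact partial sums by the hockey-stick identity; the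
difference from a multiple of it is negligible by a Cesàro estimate. -/
theorem tendsto_sum_div_pow {y : ℕ → ℝ} {c : ℝ} {k : ℕ}
    (hy : Tendsto (fun t : ℕ => y t / ((t : ℝ) + 1) ^ k) atTop (𝓝 c)) :
    Tendsto (fun t : ℕ => (∑ j ∈ Finset.range (t + 1), y j) / ((t : ℝ) + 1) ^ (k + 1)) atTop
      (𝓝 (c / (k + 1))) := by
  set d := c * k.factorial with hd
  have h1 : Tendsto (fun t : ℕ => y t / ((t : ℝ) + 1) ^ k -
      d * (((t + k).choose k : ℝ) / ((t : ℝ) + 1) ^ k)) atTop (𝓝 0) := by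
    have := hy.sub ((tendsto_choose_div_pow k).const_mul d)
    have e : c - d * (1 / (k.factorial : ℝ)) = 0 := by rw [hd]; field_simp; ring
    rwa [e] at this
  have h2 := tendsto_sum_mul_div_pow_zero (C := 1) (u := fun _ j => ((j : ℝ) + 1) ^ k) k h1
    (fun t i hi => by
      rw [abs_of_nonneg (by positivity), one_mul]
      gcongr)
  have h3 := h2.add ((tendsto_choose_div_pow (k + 1)).const_mul d)
  have e : 0 + d * (1 / ((k + 1).factorial : ℝ)) = c / (k + 1) := by
    rw [hd, Nat.factorial_succ]; push_cast; field_simp; ring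
  rw [e] at h3
  refine h3.congr fun t => ?_
  rw [← sum_range_add_choose, ← mul_div_assoc, ← add_div]
  congr 1
  push_cast
  rw [Finset.mul_sum, ← Finset.sum_add_distrib]
  refine Finset.sum_congr rfl fun j _ => ?_
  have : ((j : ℝ) + 1) ^ k ≠ 0 := by positivity
  field_simp
  ring

/-- The resonant case: both factors have exponential rate `1`, and summation raises the polynomial
degree by one. -/
theorem tendsto_conv_of_critical {b y : ℕ → ℝ} {c β : ℝ} {k : ℕ}
    (hb : Tendsto b atTop (𝓝 β))
    (hy : Tendsto (fun t : ℕ => y t / ((t : ℝ) + 1) ^ k) atTop (𝓝 c)) :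
    Tendsto (fun t : ℕ => (∑ j ∈ Finset.range (t + 1), b j * y (t - j)) /
      ((t : ℝ) + 1) ^ (k + 1)) atTop (𝓝 (β * (c / (k + 1)))) := by
  obtain ⟨C, hC⟩ := exists_abs_le_of_tendsto hy
  have h1 : Tendsto (fun t => b t - β) atTop (𝓝 0) := by
    simpa using hb.sub_const β
  have h2 := tendsto_sum_mul_div_pow_zero (C := C) (u := fun t j => y (t - j)) k h1
    (fun t i hi => by
      have h := hC (t - i)
      rw [abs_div, abs_of_pos (by positivity : (0 : ℝ) < (((t - i : ℕ) : ℝ) + 1) ^ k),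
        div_le_iff₀ (by positivity)] at h
      have hC0 : 0 ≤ C := (abs_nonneg _).trans (hC 0)
      refine h.trans (mul_le_mul_of_nonneg_left ?_ hC0)
      gcongr
      omega)
  have h3 := h2.add ((tendsto_sum_div_pow hy).const_mul β)
  rw [zero_add] at h3
  refine h3.congr fun t => ?_
  rw [← mul_div_assoc, ← add_div, ← Finset.sum_range_reflect y, Finset.mul_sum,
    ← Finset.sum_add_distrib]
  congr 1
  refine Finset.sum_congr rfl fun j _ => ?_
  have : t + 1 - 1 - j = t - j := by omega
  rw [this]
  ring

theorem HasRegularGrowth.conv_of_tendsto {b y : ℕ → ℝ} {β : ℝ} (hβ : 0 < β)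
    (hb0 : ∀ t, 0 ≤ b t) (hb : Tendsto b atTop (𝓝 β)) (hy0 : ∀ t, 0 ≤ y t)
    (hy : HasRegularGrowth y) :
    HasRegularGrowth fun t => ∑ j ∈ Finset.range (t + 1), b j * y (t - j) := by
  -- With `y` summable, the roles are swapped: `y` gives the weights and `b` tends to `β`.
  have hsummable : Summable y →
      HasRegularGrowth fun t => ∑ j ∈ Finset.range (t + 1), b j * y (t - j) := by
    intro hs
    by_cases h0 : ∀ t, y t = 0
    · simpa [h0] using HasRegularGrowth.zero
    push Not at h0
    obtain ⟨i, hi⟩ := h0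
    obtain ⟨C, hC⟩ := exists_abs_le_of_tendsto hb
    have h1 := tendsto_sum_range_of_dominated (w := fun t i => b (t - i)) (c := β) (C := C) hs hy0
      (fun i => hb.comp (tendsto_sub_atTop_nat i)) (fun t i _ => hC _)
    refine Or.inr ⟨(∑' i, y i) * β, 1, 0,
      mul_pos (hs.tsum_pos hy0 i ((hy0 i).lt_of_ne' hi)) hβ, one_pos, ?_⟩
    refine h1.congr fun t => ?_
    simp only [one_pow, pow_zero, mul_one, div_one]
    rw [← Finset.sum_range_reflect (fun j => b j * y (t - j))]
    refine Finset.sum_congr rfl fun j hj => ?_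
    have h2 : t + 1 - 1 - j = t - j := by omega
    have h3 : t - (t - j) = j := by simp at hj; omega
    rw [h2, h3, mul_comm]
  rcases hy with hy | ⟨c, m, k, hc, hm, hy⟩
  · apply hsummable
    obtain ⟨N, hN⟩ := eventually_atTop.1 hy
    exact summable_of_ne_finset_zero (s := Finset.range N) fun t ht => hN t (by simpa using ht)
  rcases lt_trichotomy m 1 with h | rfl | h
  · apply hsummable
    obtain ⟨C, hC⟩ := exists_abs_le_of_tendsto hy
    -- The room between `m` and `r` absorbs the polynomial factor.
    obtain ⟨r, hr1, hr2⟩ := exists_between h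
    have hr0 : 0 < r := hm.trans hr1
    obtain ⟨D, hD⟩ := exists_abs_le_of_tendsto
      (tendsto_pow_mul_succ_pow_zero (div_pos hm hr0) ((div_lt_one hr0).2 hr1) k)
    have hC0 : 0 ≤ C := (abs_nonneg _).trans (hC 0)
    refine Summable.of_nonneg_of_le hy0 (fun t => ?_)
      ((summable_geometric_of_lt_one hr0.le hr2).mul_left (C * D))
    have h1 := (le_abs_self _).trans (hC t)
    rw [div_le_iff₀ (by positivity)] at h1
    have h2 := (le_abs_self _).trans (hD t)
    have h3 : m ^ t * ((t : ℝ) + 1) ^ k ≤ D * r ^ t := by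
      rw [div_pow, div_mul_eq_mul_div, div_le_iff₀ (by positivity)] at h2
      exact h2
    calc y t ≤ _ := h1
      _ ≤ C * (D * r ^ t) := mul_le_mul_of_nonneg_left h3 hC0
      _ = _ := by ring
  · have h1 := tendsto_conv_of_critical hb (k := k) (y := y) (c := c) (by simpa using hy)
    exact Or.inr ⟨β * (c / (k + 1)), 1, k + 1, by positivity, one_pos, by simpa using h1⟩
  · obtain ⟨C, hC⟩ := exists_abs_le_of_tendsto hy
    obtain ⟨D, hD⟩ := exists_abs_le_of_tendsto hb
    have hC0 : 0 ≤ C := (abs_nonneg _).trans (hC 0)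
    have hm' : m⁻¹ < 1 := inv_lt_one_of_one_lt₀ h
    have hs : Summable fun i => b i * m⁻¹ ^ i := by
      refine Summable.of_nonneg_of_le (fun i => mul_nonneg (hb0 i) (by positivity)) (fun i => ?_)
        ((summable_geometric_of_lt_one (by positivity) hm').mul_left D)
      exact mul_le_mul_of_nonneg_right ((le_abs_self _).trans (hD i)) (by positivity)
    have hpos : 0 < ∑' i, b i * m⁻¹ ^ i := by
      obtain ⟨i, hi⟩ := (hb.eventually (lt_mem_nhds hβ)).exists
      exact hs.tsum_pos (fun i => mul_nonneg (hb0 i) (by positivity)) i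
        (mul_pos hi (by positivity))
    -- For `m > 1` the forcing dominates: dividing by `m ^ t * (t + 1) ^ k` leaves summable weights
    -- `b i * m⁻¹ ^ i`.
    have h1 := tendsto_sum_range_of_dominated (c := c * 1) (C := C)
      (w := fun t i => y (t - i) / (m ^ (t - i) * (((t - i : ℕ) : ℝ) + 1) ^ k) *
        ((((t - i : ℕ) : ℝ) + 1) / ((t : ℝ) + 1)) ^ k) hs
      (fun i => mul_nonneg (hb0 i) (by positivity)) (fun i => ?_) (fun t i hi => ?_)
    · refine Or.inr ⟨_, m, k, mul_pos hpos (by simpa using hc), hm, h1.congr fun t => ?_⟩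
      rw [Finset.sum_div]
      refine Finset.sum_congr rfl fun i hi => ?_
      have h2 : m ^ t = m ^ (t - i) * m ^ i := by
        rw [← pow_add]; congr 1; simp at hi; omega
      rw [h2, div_pow, inv_pow]
      field_simp
    · refine (hy.comp (tendsto_sub_atTop_nat i)).mul ?_
      have h2 : Tendsto (fun t : ℕ => (1 - i * ((t : ℝ) + 1)⁻¹) ^ k) atTop
          (𝓝 ((1 - i * 0) ^ k)) :=
        (tendsto_const_nhds.sub ((tendsto_inv_atTop_zero.comp
          tendsto_natCast_add_one_atTop).const_mul _)).pow k
      rw [mul_zero, sub_zero, one_pow] at h2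
      refine h2.congr' ?_
      filter_upwards [eventually_ge_atTop i] with t ht
      rw [Nat.cast_sub ht]
      congr 1
      field_simp
      ring
    · rw [abs_mul, ← mul_one C]
      refine mul_le_mul (hC _) ?_ (abs_nonneg _) hC0
      rw [abs_of_nonneg (by positivity)]
      refine pow_le_one₀ (by positivity) ((div_le_one (by positivity)).2 ?_)
      gcongr
      omega

/-- Dividing both factors by powers of `ρ` commutes with convolution and reduces to `ρ = 1`. -/
theorem HasRegularGrowth.conv {b y : ℕ → ℝ} {β ρ : ℝ} (hβ : 0 < β) (hρ : 0 < ρ)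
    (hb0 : ∀ t, 0 ≤ b t) (hb : Tendsto (fun t => b t / ρ ^ t) atTop (𝓝 β))
    (hy0 : ∀ t, 0 ≤ y t) (hy : HasRegularGrowth y) :
    HasRegularGrowth fun t => ∑ j ∈ Finset.range (t + 1), b j * y (t - j) := by
  have h1 := hy.mul_pow (inv_pos.2 hρ)
  have h2 := (conv_of_tendsto hβ (fun t => div_nonneg (hb0 t) (by positivity)) hb
    (fun t => mul_nonneg (hy0 t) (by positivity)) h1).mul_pow hρ
  refine h2.congr (Eventually.of_forall fun t => ?_)
  simp only
  rw [Finset.sum_mul]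
  refine Finset.sum_congr rfl fun j hj => ?_
  have h2 : ρ ^ t = ρ ^ (t - j) * ρ ^ j := by
    rw [← pow_add]; congr 1; simp at hj; omega
  rw [h2, inv_pow]
  field_simp

/-! ### Perron–Frobenius for positive matrices -/

section Perron

variable {n : Type*} [Fintype n] [DecidableEq n]

/-- A matrix with positive entries has a positive eigenvector for a positive eigenvalue. -/
theorem exists_pos_eigenvector [Nonempty n] (B : Matrix n n ℝ) (hB : ∀ i j, 0 < B i j) :
    ∃ (ρ : ℝ) (x : n → ℝ), 0 < ρ ∧ (∀ i, 0 < x i) ∧ B.mulVec x = ρ • x := by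
  have hpos : ∀ z : n → ℝ, (∀ i, 0 ≤ z i) → z ≠ 0 → ∀ i, 0 < B.mulVec z i := by
    intro z hz hz0 i
    obtain ⟨j, hj⟩ := Function.ne_iff.1 hz0
    exact Finset.sum_pos' (fun l _ => mul_nonneg (hB i l).le (hz l))
      ⟨j, Finset.mem_univ j, mul_pos (hB i j) ((hz j).lt_of_ne' hj)⟩
  set R := ∑ i, ∑ j, B i j with hR
  have hbound : ∀ (r : ℝ) (x : n → ℝ), x ∈ stdSimplex ℝ n → (∀ i, r * x i ≤ B.mulVec x i) →
      r ≤ R := by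
    intro r x hx h
    calc r = ∑ i, r * x i := by rw [← Finset.mul_sum, hx.2, mul_one]
      _ ≤ ∑ i, B.mulVec x i := Finset.sum_le_sum fun i _ => h i
      _ ≤ R := by
        refine Finset.sum_le_sum fun i _ => Finset.sum_le_sum fun j _ => ?_
        refine mul_le_of_le_one_right (hB i j).le ?_
        rw [← hx.2]
        exact Finset.single_le_sum (fun l _ => hx.1 l) (Finset.mem_univ j)
  -- Collatz–Wielandt: the eigenvalue is the largest `r` admitting `r x ≤ B x` on the simplex.
  let K : Set (ℝ × (n → ℝ)) :=
    (Set.Icc 0 R ×ˢ stdSimplex ℝ n) ∩ {p | ∀ i, p.1 * p.2 i ≤ B.mulVec p.2 i}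
  have hK : IsCompact K := by
    refine (isCompact_Icc.prod (isCompact_stdSimplex ℝ n)).inter_right ?_
    simp only [Set.ofPred_forall]
    refine isClosed_iInter fun i => isClosed_le (by fun_prop) ?_
    simp only [Matrix.mulVec, dotProduct]
    fun_prop
  have hne : K.Nonempty := by
    obtain ⟨i⟩ := ‹Nonempty n›
    have h1 := single_mem_stdSimplex ℝ i
    have h2 : ∀ l, (0 : ℝ) * (Pi.single i 1 : n → ℝ) l ≤ B.mulVec (Pi.single i 1) l := by
      intro l
      rw [zero_mul]
      exact Finset.sum_nonneg fun j _ => mul_nonneg (hB l j).le (h1.1 j)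
    exact ⟨(0, Pi.single i 1), ⟨⟨⟨le_rfl, hbound _ _ h1 h2⟩, h1⟩, h2⟩⟩
  obtain ⟨⟨r, x⟩, ⟨⟨⟨hr0, _⟩, hx⟩, hrx⟩, hmax⟩ := hK.exists_isMaxOn hne continuous_fst.continuousOn
  simp only at hr0 hx hrx
  have hx0 : x ≠ 0 := by
    rintro rfl
    simpa using hx.2
  have hy := hpos x hx.1 hx0
  have heq : B.mulVec x = r • x := by
    by_contra hcon
    set y := B.mulVec x with hydef
    -- Applying `B` to the nonzero defect `y - r x ≥ 0` makes it strictly positive, so `y = B x`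
    -- admits a larger `r`.
    have hz := hpos (y - r • x) (fun i => by simpa using hrx i) (sub_ne_zero.2 hcon)
    have hz' : ∀ i, r < B.mulVec y i / y i := by
      intro i
      have := hz i
      rw [Matrix.mulVec_sub, Matrix.mulVec_smul, ← hydef] at this
      rw [lt_div_iff₀ (hy i)]
      simpa using this
    obtain ⟨i0, hi0⟩ := Finite.exists_min fun i => B.mulVec y i / y i
    set r' := B.mulVec y i0 / y i0
    set S := ∑ i, y i with hS
    have hS0 : 0 < S := Finset.sum_pos (fun i _ => hy i) Finset.univ_nonempty
    have hy1 : S⁻¹ • y ∈ stdSimplex ℝ n := by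
      refine ⟨fun i => ?_, ?_⟩
      · exact mul_nonneg (inv_nonneg.2 hS0.le) (hy i).le
      · simp only [Pi.smul_apply, smul_eq_mul, ← Finset.mul_sum]
        exact inv_mul_cancel₀ hS0.ne'
    have hy2 : ∀ i, r' * (S⁻¹ • y) i ≤ B.mulVec (S⁻¹ • y) i := by
      intro i
      rw [Matrix.mulVec_smul]
      have := (le_div_iff₀ (hy i)).1 (hi0 i)
      simp only [Pi.smul_apply, smul_eq_mul]
      rw [mul_left_comm]
      exact mul_le_mul_of_nonneg_left this (inv_nonneg.2 hS0.le)
    have hmem : (r', S⁻¹ • y) ∈ K :=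
      ⟨⟨⟨hr0.trans (hz' i0).le, hbound _ _ hy1 hy2⟩, hy1⟩, hy2⟩
    exact absurd (hmax hmem) (not_le.2 (hz' i0))
  have hrx' : ∀ i, 0 < r * x i := fun i => by simpa [heq] using hy i
  refine ⟨r, x, ?_, fun i => pos_of_mul_pos_right (hrx' i) hr0, heq⟩
  exact pos_of_mul_pos_left (hrx' (Classical.arbitrary n)) (hx.1 _)

/-- A stochastic matrix with entries at least `δ` contracts oscillations by `1 - δ`. -/
theorem mulVec_sub_le_of_stochastic {Q : Matrix n n ℝ} {δ : ℝ}
    (hδ : ∀ i j, δ ≤ Q i j) (hδ0 : 0 < δ) (hQ : ∀ i, ∑ j, Q i j = 1) {f : n → ℝ} {d : ℝ}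
    (hf : ∀ i j, f i - f j ≤ d) (i j : n) :
    Q.mulVec f i - Q.mulVec f j ≤ (1 - δ) * d := by
  have : Nonempty n := ⟨i⟩
  obtain ⟨l, hl⟩ := Finite.exists_min f
  have hd : 0 ≤ d := by simpa using hf l l
  have hQ0 : ∀ i j, 0 ≤ Q i j := fun i j => hδ0.le.trans (hδ i j)
  have h1 : f l ≤ Q.mulVec f j := by
    calc f l = ∑ k, Q j k * f l := by rw [← Finset.sum_mul, hQ, one_mul]
      _ ≤ _ := Finset.sum_le_sum fun k _ => mul_le_mul_of_nonneg_left (hl k) (hQ0 j k)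
  have h2 : Q.mulVec f i ≤ f l + (1 - δ) * d := by
    calc Q.mulVec f i ≤ ∑ k, (Q i k * (f l + d) - if k = l then Q i k * d else 0) := by
          refine Finset.sum_le_sum fun k _ => ?_
          split_ifs with h
          · rw [h]; linarith
          · rw [sub_zero]
            exact mul_le_mul_of_nonneg_left (by linarith [hf k l]) (hQ0 i k)
      _ = f l + d - Q i l * d := by
          rw [Finset.sum_sub_distrib, ← Finset.sum_mul, hQ, one_mul]
          simp
      _ ≤ _ := by nlinarith [mul_le_mul_of_nonneg_right (hδ i l) hd]
  linarith

/-- Averaging moves each value by at most the current oscillation, which decays geometrically. -/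
theorem exists_tendsto_pow_mulVec_of_stochastic {Q : Matrix n n ℝ} {δ : ℝ}
    (hδ : ∀ i j, δ ≤ Q i j) (hδ0 : 0 < δ) (hQ : ∀ i, ∑ j, Q i j = 1) (f : n → ℝ) (i : n) :
    ∃ c, Tendsto (fun t : ℕ => (Q ^ t).mulVec f i) atTop (𝓝 c) := by
  obtain ⟨d, hd⟩ : ∃ d, ∀ i j, f i - f j ≤ d := by
    have : Nonempty n := ⟨i⟩
    obtain ⟨l, hl⟩ := Finite.exists_min f
    obtain ⟨m, hm⟩ := Finite.exists_max f
    exact ⟨f m - f l, fun i j => sub_le_sub (hm i) (hl j)⟩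
  have hQ0 : ∀ i j, 0 ≤ Q i j := fun i j => hδ0.le.trans (hδ i j)
  have hδ1 : δ ≤ 1 := by
    rw [← hQ i]
    exact (hδ i i).trans (Finset.single_le_sum (fun j _ => hQ0 i j) (Finset.mem_univ i))
  have hosc : ∀ t : ℕ, ∀ i j, (Q ^ t).mulVec f i - (Q ^ t).mulVec f j ≤ (1 - δ) ^ t * d := by
    intro t
    induction t with
    | zero => simpa using hd
    | succ t ih =>
      intro i j
      rw [pow_succ' Q, ← Matrix.mulVec_mulVec, pow_succ', mul_assoc]
      exact mulVec_sub_le_of_stochastic hδ hδ0 hQ ih i j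
  refine cauchySeq_tendsto_of_complete
    (cauchySeq_of_le_geometric (1 - δ) d (by linarith) fun t => ?_)
  rw [Real.dist_eq, pow_succ' Q, ← Matrix.mulVec_mulVec]
  set g := (Q ^ t).mulVec f with hg
  have h1 : g i - Q.mulVec g i = ∑ j, Q i j * (g i - g j) := by
    simp only [mul_sub, Finset.sum_sub_distrib, ← Finset.sum_mul, hQ, one_mul]
    rfl
  rw [h1]
  calc |∑ j, Q i j * (g i - g j)| ≤ ∑ j, |Q i j * (g i - g j)| := Finset.abs_sum_le_sum_abs _ _
    _ ≤ ∑ j, Q i j * ((1 - δ) ^ t * d) := by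
        refine Finset.sum_le_sum fun j _ => ?_
        rw [abs_mul, abs_of_nonneg (hQ0 i j)]
        exact mul_le_mul_of_nonneg_left (abs_sub_le_iff.2 ⟨hosc t i j, hosc t j i⟩) (hQ0 i j)
    _ = d * (1 - δ) ^ t := by rw [← Finset.sum_mul, hQ, one_mul, mul_comm]

theorem exists_tendsto_pow_of_stochastic {Q : Matrix n n ℝ} {δ : ℝ}
    (hδ : ∀ i j, δ ≤ Q i j) (hδ0 : 0 < δ) (hQ : ∀ i, ∑ j, Q i j = 1) (i j : n) :
    ∃ c, 0 < c ∧ Tendsto (fun t : ℕ => (Q ^ t) i j) atTop (𝓝 c) := by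
  obtain ⟨c, hc⟩ := exists_tendsto_pow_mulVec_of_stochastic hδ hδ0 hQ (Pi.single j 1) i
  simp only [Matrix.mulVec_single_one, Matrix.col_apply] at hc
  have hQ0 : ∀ i j, 0 ≤ Q i j := fun i j => hδ0.le.trans (hδ i j)
  -- The bound starts at exponent `1`, as `Q ^ 0` may have zero entries; it keeps the limit
  -- positive.
  have h : ∀ t : ℕ, ∀ i, δ ≤ (Q ^ (t + 1)) i j := by
    intro t
    induction t with
    | zero => simpa using fun i => hδ i j
    | succ t ih =>
      intro i
      rw [pow_succ', Matrix.mul_apply]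
      calc δ = ∑ k, Q i k * δ := by rw [← Finset.sum_mul, hQ, one_mul]
        _ ≤ _ := Finset.sum_le_sum fun k _ => mul_le_mul_of_nonneg_left (ih k) (hQ0 i k)
  exact ⟨c, hδ0.trans_le (ge_of_tendsto' ((tendsto_add_atTop_iff_nat 1).2 hc) fun t => h t i), hc⟩

/-- The entries of the powers of a positive matrix are asymptotic to `c * ρ ^ t`. -/
theorem exists_tendsto_pow_div_pow (B : Matrix n n ℝ) (hB : ∀ i j, 0 < B i j) :
    ∃ ρ : ℝ, 0 < ρ ∧ ∀ i j, ∃ c, 0 < c ∧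
      Tendsto (fun t : ℕ => (B ^ t) i j / ρ ^ t) atTop (𝓝 c) := by
  cases isEmpty_or_nonempty n with
  | inl h => exact ⟨1, one_pos, fun i => h.elim i⟩
  | inr hn =>
  obtain ⟨ρ, x, hρ, hx, hBx⟩ := exists_pos_eigenvector B hB
  -- Conjugating by the diagonal of the eigenvector and dividing by `ρ` makes `B` stochastic.
  let Q : Matrix n n ℝ := fun i j => B i j * x j / (ρ * x i)
  have hQ0 : ∀ i j, 0 < Q i j := fun i j =>
    div_pos (mul_pos (hB i j) (hx j)) (mul_pos hρ (hx i))
  obtain ⟨p, hp⟩ := Finite.exists_min fun p : n × n => Q p.1 p.2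
  have hQ1 : ∀ i, ∑ j, Q i j = 1 := by
    intro i
    have h := congrFun hBx i
    simp only [Matrix.mulVec, dotProduct, Pi.smul_apply, smul_eq_mul] at h
    simp only [Q]
    rw [← Finset.sum_div, h, div_self (mul_pos hρ (hx i)).ne']
  have hpow : ∀ t : ℕ, ∀ i j, (Q ^ t) i j = (B ^ t) i j / ρ ^ t * (x j / x i) := by
    intro t
    induction t with
    | zero =>
      intro i j
      by_cases h : i = j
      · subst h; simp [(hx i).ne']
      · simp [h]
    | succ t ih =>
      intro i j
      rw [pow_succ', pow_succ', Matrix.mul_apply, Matrix.mul_apply, Finset.sum_div, Finset.sum_mul]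
      refine Finset.sum_congr rfl fun k _ => ?_
      have := (hx i).ne'
      have := (hx k).ne'
      rw [ih]
      simp only [Q]
      field_simp
      ring
  refine ⟨ρ, hρ, fun i j => ?_⟩
  obtain ⟨c, hc, h⟩ := exists_tendsto_pow_of_stochastic (fun i j => hp (i, j)) (hQ0 _ _) hQ1 i j
  have hxi := hx i
  have hxj := hx j
  refine ⟨c * (x i / x j), by positivity, (h.mul_const (x i / x j)).congr fun t => ?_⟩
  rw [hpow]
  field_simp

end Perron

/-! ### Nonnegative matrices and their zero patterns -/

theorem mul_apply_pos_iff {n : Type*} [Fintype n] {X Y : Matrix n n ℝ} (hX : ∀ i j, 0 ≤ X i j)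
    (hY : ∀ i j, 0 ≤ Y i j) (i j : n) : 0 < (X * Y) i j ↔ ∃ k, 0 < X i k ∧ 0 < Y k j := by
  rw [Matrix.mul_apply, Finset.sum_pos_iff_of_nonneg fun k _ => mul_nonneg (hX i k) (hY k j)]
  refine exists_congr fun k => ⟨fun h => ?_, fun h => ⟨Finset.mem_univ k, mul_pos h.1 h.2⟩⟩
  exact ⟨pos_of_mul_pos_left h.2 (hY k j), pos_of_mul_pos_right h.2 (hX i k)⟩

section NonnegMatrix

variable {n : Type*} [Fintype n] [DecidableEq n]

theorem pow_apply_nonneg {M : Matrix n n ℝ} (hM : ∀ i j, 0 ≤ M i j) (t : ℕ) (i j : n) :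
    0 ≤ (M ^ t) i j := by
  induction t generalizing i j with
  | zero => rw [pow_zero, Matrix.one_apply]; split_ifs <;> norm_num
  | succ t ih =>
    rw [pow_succ, Matrix.mul_apply]
    exact Finset.sum_nonneg fun k _ => mul_nonneg (ih i k) (hM k j)

/-- Some power of a nonnegative matrix has an idempotent zero pattern. -/
theorem exists_pow_pattern_idempotent {M : Matrix n n ℝ} (hM : ∀ i j, 0 ≤ M i j) :
    ∃ s : ℕ, 1 ≤ s ∧ ∀ i j, 0 < (M ^ s) i j ↔ 0 < (M ^ (s + s)) i j := by
  let pat : ℕ → n → n → Prop := fun t i j => 0 < (M ^ t) i j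
  -- The pattern of a product depends only on those of its factors, and there are finitely many
  -- patterns, so the sequence is eventually periodic.
  have hadd : ∀ p q r, pat p = pat q → pat (p + r) = pat (q + r) := by
    intro p q r h
    funext i j
    simp only [pat, pow_add]
    rw [mul_apply_pos_iff (pow_apply_nonneg hM _) (pow_apply_nonneg hM _),
      mul_apply_pos_iff (pow_apply_nonneg hM _) (pow_apply_nonneg hM _)]
    exact propext (exists_congr fun k => and_congr_left' (iff_of_eq (congrFun₂ h i k)))
  obtain ⟨p, d, hd, hpd⟩ : ∃ p d, 1 ≤ d ∧ pat p = pat (p + d) := by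
    obtain ⟨p, q, hpq, h⟩ := Finite.exists_ne_map_eq_of_infinite pat
    rcases hpq.lt_or_gt with hlt | hlt
    · exact ⟨p, q - p, by omega, by rwa [Nat.add_sub_cancel' hlt.le]⟩
    · exact ⟨q, p - q, by omega, by rw [Nat.add_sub_cancel' hlt.le, h]⟩
  have hper : ∀ t, p ≤ t → ∀ m, pat t = pat (t + m * d) := by
    intro t ht m
    induction m with
    | zero => simp
    | succ m ih =>
      have h := hadd _ _ (t - p + m * d) hpd
      have e1 : p + (t - p + m * d) = t + m * d := by omega
      have e2 : p + d + (t - p + m * d) = t + (m + 1) * d := by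
        rw [add_mul, one_mul]; omega
      rw [ih, ← e1, h, e2]
  have hle : p ≤ (p + 1) * d := by nlinarith
  -- This exponent is past the preperiod `p` and a multiple of the period `d`, so doubling it
  -- preserves the pattern.
  refine ⟨(p + 1) * d, by nlinarith, fun i j => ?_⟩
  exact iff_of_eq (congrFun₂ (hper _ hle (p + 1)) i j)

theorem affine_recurrence {B : Matrix n n ℝ} {x y : ℕ → n → ℝ}
    (h : ∀ t, x (t + 1) = B.mulVec (x t) + y t) (t : ℕ) :
    x (t + 1) = (B ^ (t + 1)).mulVec (x 0) +
      ∑ j ∈ Finset.range (t + 1), (B ^ j).mulVec (y (t - j)) := by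
  induction t with
  | zero => simp [h]
  | succ t ih =>
    rw [h, ih, Matrix.mulVec_add, Matrix.mulVec_mulVec, ← pow_succ', Finset.sum_range_succ' _ (t + 1),
      Matrix.mulVec_sum, add_assoc]
    congr 2
    · refine Finset.sum_congr rfl fun j _ => ?_
      rw [Matrix.mulVec_mulVec, ← pow_succ', Nat.add_sub_add_right]
    · simp

/-- Solutions of `x (t + 1) = B x t + y t` with `B` positive and `y` of regular growth have
regular growth. -/
theorem HasRegularGrowth.of_affine_recurrence {B : Matrix n n ℝ} (hB : ∀ i j, 0 < B i j)
    {x y : ℕ → n → ℝ} (h : ∀ t, x (t + 1) = B.mulVec (x t) + y t) (hx : ∀ i, 0 ≤ x 0 i)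
    (hy0 : ∀ t i, 0 ≤ y t i) (hy : ∀ i, HasRegularGrowth fun t => y t i) (i : n) :
    HasRegularGrowth fun t => x t i := by
  obtain ⟨ρ, hρ, hlim⟩ := exists_tendsto_pow_div_pow B hB
  have h1 : HasRegularGrowth fun t => ∑ k, x 0 k * (B ^ (t + 1)) i k := by
    refine HasRegularGrowth.sum _ fun k _ => HasRegularGrowth.const_mul ?_ (hx k)
    obtain ⟨c, hc, hck⟩ := hlim i k
    refine Or.inr ⟨c * ρ, ρ, 0, by positivity, hρ, ?_⟩
    refine (((tendsto_add_atTop_iff_nat 1).2 hck).mul_const ρ).congr fun t => ?_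
    rw [pow_succ ρ, pow_zero, mul_one]
    field_simp
  have h2 : HasRegularGrowth fun t => ∑ k, ∑ j ∈ Finset.range (t + 1),
      (B ^ j) i k * y (t - j) k := by
    refine HasRegularGrowth.sum _ fun k _ => ?_
    obtain ⟨c, hc, hck⟩ := hlim i k
    exact HasRegularGrowth.conv (y := fun t => y t k) hc hρ
      (fun t => pow_apply_nonneg (fun i j => (hB i j).le) t i k) hck (fun t => hy0 t k) (hy k)
  refine HasRegularGrowth.of_shift ((h1.add h2).congr (Eventually.of_forall fun t => ?_))
  simp only
  rw [affine_recurrence h, Finset.sum_comm]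
  simp [Matrix.mulVec, dotProduct, Finset.sum_apply, mul_comm]

/-- If the zero pattern of `P` is idempotent, the entries of its powers have regular growth. -/
theorem HasRegularGrowth.pow_apply_of_pattern {P : Matrix n n ℝ} (hP : ∀ i j, 0 ≤ P i j)
    (hidem : ∀ i j, 0 < P i j ↔ 0 < (P * P) i j) (i a : n) :
    HasRegularGrowth fun t => (P ^ t) i a := by
  have htrans : ∀ {i k j}, 0 < P i k → 0 < P k j → 0 < P i j := fun {i k j} h1 h2 =>
    (hidem i j).2 ((mul_apply_pos_iff hP hP i j).2 ⟨k, h1, h2⟩)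
  -- The strict order on classes: `j` lies below `i` if `i` leads to `j` but not conversely.
  let r : n → n → Prop := fun j i => 0 < P i j ∧ ¬ 0 < P j i
  have : IsTrans n r := ⟨fun i j k h1 h2 => ⟨htrans h2.1 h1.1, fun h => h2.2 (htrans h1.1 h)⟩⟩
  have : Std.Irrefl r := ⟨fun i h => h.2 h.1⟩
  have hwf : WellFounded r := Finite.wellFounded_of_trans_of_irrefl r
  induction i using hwf.induction with
  | _ i ih =>
  have hstep : ∀ t c, (P ^ (t + 1)) c a = ∑ d, P c d * (P ^ t) d a := fun t c => by
    rw [pow_succ', Matrix.mul_apply]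
  by_cases hi : 0 < P i i
  -- The class of `i` is a positive block; `y` collects the contributions from outside it, which
  -- come only from lower indices.
  · let C : Type _ := {c : n // 0 < P i c ∧ 0 < P c i}
    let x : ℕ → C → ℝ := fun t c => (P ^ t) c.1 a
    let y : ℕ → C → ℝ := fun t c =>
      ∑ d ∈ Finset.univ.filter fun d => ¬ (0 < P i d ∧ 0 < P d i), P c.1 d * (P ^ t) d a
    let B : Matrix C C ℝ := fun c d => P c.1 d.1
    have h := HasRegularGrowth.of_affine_recurrence (B := B) (x := x) (y := y)
      (fun c d => htrans c.2.2 d.2.1) ?_ (fun c => pow_apply_nonneg hP _ _ _)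
      (fun t c => Finset.sum_nonneg fun d _ => mul_nonneg (hP _ _) (pow_apply_nonneg hP _ _ _)) ?_
      ⟨i, hi, hi⟩
    · exact h
    · intro t
      funext c
      simp only [x, y, B, Pi.add_apply, Matrix.mulVec, dotProduct]
      rw [hstep, ← Finset.sum_filter_add_sum_filter_not Finset.univ
        (fun d => 0 < P i d ∧ 0 < P d i)]
      congr 1
      exact Finset.sum_subtype _ (by simp) _
    · intro c
      refine HasRegularGrowth.sum _ fun d hd => ?_
      rcases (hP c.1 d).eq_or_lt with h0 | h0
      · simpa [← h0] using HasRegularGrowth.zero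
      · have h1 : 0 < P i d := htrans c.2.1 h0
        refine (ih d ⟨h1, fun h2 => ?_⟩).const_mul h0.le
        exact (Finset.mem_filter.1 hd).2 ⟨h1, h2⟩
  · refine HasRegularGrowth.of_shift ?_
    simp only [hstep]
    refine HasRegularGrowth.sum _ fun d _ => ?_
    rcases (hP i d).eq_or_lt with h0 | h0
    · simpa [← h0] using HasRegularGrowth.zero
    · exact (ih d ⟨h0, fun h => hi (htrans h0 h)⟩).const_mul h0.le

theorem exists_pow_hasRegularGrowth {M : Matrix n n ℝ} (hM : ∀ i j, 0 ≤ M i j) :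
    ∃ s : ℕ, 1 ≤ s ∧ ∀ i j, HasRegularGrowth fun t => ((M ^ s) ^ t) i j := by
  obtain ⟨s, hs, h⟩ := exists_pow_pattern_idempotent hM
  refine ⟨s, hs, HasRegularGrowth.pow_apply_of_pattern (pow_apply_nonneg hM s) fun i j => ?_⟩
  rw [h, pow_add]

end NonnegMatrix

/-! ### Letter counts and occurrences in iterated words -/

namespace Substitution

variable {A : Type*}

theorem extend_power (ξ : A → FreeMonoid A) (s : ℕ) : extend (power ξ s) = extend ξ ^ s :=
  FreeMonoid.hom_eq fun a => FreeMonoid.lift_eval_of _ a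

theorem extend_apply_of (ξ : A → FreeMonoid A) (a : A) : extend ξ (FreeMonoid.of a) = ξ a :=
  FreeMonoid.lift_eval_of ξ a

theorem power_power (ξ : A → FreeMonoid A) (s t : ℕ) : power (power ξ s) t = power ξ (s * t) := by
  funext a
  rw [power, extend_power, ← pow_mul, power]

theorem power_add (ξ : A → FreeMonoid A) (m t : ℕ) (a : A) :
    power ξ (m + t) a = extend (power ξ m) (power ξ t a) := by
  rw [extend_power, power, pow_add]
  rfl

theorem toList_extend (ξ : A → FreeMonoid A) (u : FreeMonoid A) :
    (extend ξ u).toList = u.toList.flatMap fun a => (ξ a).toList := by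
  induction u using FreeMonoid.recOn with
  | one => simp
  | of_mul a u ih => simp [ih, extend_apply_of]

theorem length_extend (ξ : A → FreeMonoid A) (u : FreeMonoid A) :
    (extend ξ u).length = (u.toList.map fun a => (ξ a).length).sum := by
  have h := congrArg List.length (toList_extend ξ u)
  rw [List.length_flatMap] at h
  exact h

theorem mul_length_le_length_extend {ξ : A → FreeMonoid A} {c : ℕ} (h : ∀ a, c ≤ (ξ a).length)
    (u : FreeMonoid A) : c * u.length ≤ (extend ξ u).length := by
  rw [length_extend]
  have := List.card_nsmul_le_sum (u.toList.map fun a => (ξ a).length) c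
    (by simpa using fun a _ => h a)
  rw [List.length_map, smul_eq_mul, mul_comm] at this
  exact this

theorem pow_le_length_power {ξ : A → FreeMonoid A} {c : ℕ} (h : ∀ a, c ≤ (ξ a).length)
    (t : ℕ) (a : A) : c ^ t ≤ (power ξ t a).length := by
  induction t with
  | zero => simp [power]
  | succ t ih =>
    rw [add_comm t 1, power_add, add_comm 1 t, pow_succ']
    refine le_trans (Nat.mul_le_mul_left c ih) (mul_length_le_length_extend (fun a => ?_) _)
    simpa [power, extend_apply_of] using h a

theorem IsExpanding.power {ξ : A → FreeMonoid A} (h : IsExpanding ξ) {s : ℕ} (hs : 1 ≤ s) :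
    IsExpanding (power ξ s) := by
  obtain ⟨k, hk, h⟩ := h
  refine ⟨k, hk, fun a => ?_⟩
  rw [power_power, mul_comm, ← power_power]
  exact (Nat.le_self_pow (by omega) 2).trans (pow_le_length_power h s a)

variable [DecidableEq A]

theorem sum_map_eq_sum_count [Fintype A] (l : List A) (g : A → ℕ) :
    (l.map g).sum = ∑ b, g b * l.count b := by
  induction l with
  | nil => simp
  | cons a l ih =>
    simp only [List.map_cons, List.sum_cons, ih, List.count_cons, mul_add, Finset.sum_add_distrib]
    simp [add_comm]

/-- The incidence matrix of a substitution. -/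
def incidence (ξ : A → FreeMonoid A) : Matrix A A ℝ := fun b a => ((ξ a).toList.count b : ℝ)

theorem incidence_extend [Fintype A] (ξ : A → FreeMonoid A) (u : FreeMonoid A) (b : A) :
    ((extend ξ u).toList.count b : ℝ) = ∑ c, incidence ξ b c * (u.toList.count c : ℝ) := by
  rw [toList_extend, List.count_flatMap, sum_map_eq_sum_count]
  simp [incidence]

theorem incidence_power [Fintype A] (ξ : A → FreeMonoid A) (t : ℕ) :
    incidence (power ξ t) = incidence ξ ^ t := by
  induction t with
  | zero =>
    ext b a
    simp [incidence, power, Matrix.one_apply, List.count_singleton, @eq_comm _ b a]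
  | succ t ih =>
    ext b a
    rw [pow_succ', ← ih, Matrix.mul_apply]
    have h : power ξ (t + 1) a = extend ξ (power ξ t a) := by
      rw [power, pow_succ']; rfl
    rw [incidence, h, incidence_extend]
    rfl

theorem occurrences_cons (w u : FreeMonoid A) (a : A) :
    occurrences w (FreeMonoid.of a * u) =
      occurrences w u + if w.toList <+: a :: u.toList then 1 else 0 := by
  simp [occurrences, List.countP_cons]

theorem occurrences_one {w : FreeMonoid A} (hw : w ≠ 1) : occurrences w 1 = 0 := by
  have : w.toList ≠ [] := fun h => hw h
  simp [occurrences, this]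

theorem occurrences_le_length {w : FreeMonoid A} (hw : w ≠ 1) (u : FreeMonoid A) :
    occurrences w u ≤ u.length := by
  induction u using FreeMonoid.recOn with
  | one => simp [occurrences_one hw]
  | of_mul a u ih =>
    rw [occurrences_cons, FreeMonoid.length_mul, FreeMonoid.length_of]
    split_ifs <;> omega

/-- Only occurrences straddling the cut are new, and they start among the last `|w|` letters of `u`.
The minimum with `u.length` lets the induction close. -/
theorem occurrences_mul_bounds {w : FreeMonoid A} (hw : w ≠ 1) (u v : FreeMonoid A) :
    occurrences w u + occurrences w v ≤ occurrences w (u * v) ∧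
    occurrences w (u * v) ≤ occurrences w u + occurrences w v + min u.length w.length := by
  induction u using FreeMonoid.recOn with
  | one => simp [occurrences_one hw]
  | of_mul a u ih =>
    rw [mul_assoc, occurrences_cons, occurrences_cons, FreeMonoid.length_mul, FreeMonoid.length_of,
      FreeMonoid.toList_mul]
    have h1 : w.toList <+: a :: u.toList → w.toList <+: a :: (u.toList ++ v.toList) :=
      fun h => h.trans ⟨v.toList, by simp⟩
    have h2 : w.length ≤ 1 + u.length → w.toList <+: a :: (u.toList ++ v.toList) →
        w.toList <+: a :: u.toList := fun hl h => by
      refine List.prefix_of_prefix_length_le h (l₂ := a :: u.toList) ⟨v.toList, by simp⟩ ?_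
      rw [List.length_cons]
      exact hl.trans (add_comm _ _).le
    split_ifs with h3 h4 h4
    · omega
    · exact absurd (h1 h3) h4
    · have : ¬ w.length ≤ 1 + u.length := fun hl => h3 (h2 hl h4)
      omega
    · omega

/-- Occurrences in `F(u)` are those inside the blocks `F b`, up to an error of at most `|w|` per
block. -/
theorem abs_occurrences_extend_sub_le {w : FreeMonoid A} (hw : w ≠ 1) (F : A → FreeMonoid A)
    (u : FreeMonoid A) :
    |(occurrences w (extend F u) : ℝ) - ((u.toList.map fun b => occurrences w (F b)).sum : ℕ)| ≤
      w.length * u.length := by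
  induction u using FreeMonoid.recOn with
  | one => simp [occurrences_one hw]
  | of_mul a u ih =>
    obtain ⟨h1, h2⟩ := occurrences_mul_bounds hw (F a) (extend F u)
    have h3 := h2.trans (Nat.add_le_add_left (min_le_right _ _) _)
    rw [map_mul, extend_apply_of, FreeMonoid.length_mul, FreeMonoid.length_of,
      FreeMonoid.toList_of_mul, List.map_cons, List.sum_cons]
    rw [abs_le] at ih ⊢
    have h1' : (occurrences w (F a) + occurrences w (extend F u) : ℝ) ≤
      occurrences w (F a * extend F u) := by exact_mod_cast h1
    have h3' : (occurrences w (F a * extend F u) : ℝ) ≤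
      occurrences w (F a) + occurrences w (extend F u) + w.length := by exact_mod_cast h3
    push_cast at ih ⊢
    constructor <;> nlinarith [ih.1, ih.2, w.length.cast_nonneg (α := ℝ)]

end Substitution

/-! ### Existence of frequencies -/

/-- A real sequence whose shifts are uniformly approximated by convergent sequences converges. -/
theorem exists_tendsto_of_approx {r : ℕ → ℝ}
    (h : ∀ ε > 0, ∃ (m : ℕ) (q : ℕ → ℝ) (f : ℝ), Tendsto q atTop (𝓝 f) ∧
      ∀ t, |r (t + m) - q t| ≤ ε) : ∃ f, Tendsto r atTop (𝓝 f) := by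
  refine cauchySeq_tendsto_of_complete (Metric.cauchySeq_iff'.2 fun ε hε => ?_)
  obtain ⟨m, q, f, hq, hr⟩ := h (ε / 5) (by positivity)
  obtain ⟨N, hN⟩ := Metric.tendsto_atTop.1 hq (ε / 5) (by positivity)
  have key : ∀ t ≥ N, |r (t + m) - f| < 2 * (ε / 5) := fun t ht => by
    have h1 := hN t ht
    rw [Real.dist_eq] at h1
    calc |r (t + m) - f| ≤ |r (t + m) - q t| + |q t - f| := abs_sub_le _ _ _
      _ < _ := by linarith [hr t]
  refine ⟨N + m, fun t ht => ?_⟩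
  have h1 := key (t - m) (by omega)
  rw [Nat.sub_add_cancel (by omega)] at h1
  have h2 := key N le_rfl
  rw [Real.dist_eq]
  calc |r t - r (N + m)| ≤ |r t - f| + |f - r (N + m)| := abs_sub_le _ _ _
    _ < ε := by rw [abs_sub_comm f]; linarith

namespace Substitution

/-- If the letter counts of the iterates grow regularly, all word frequencies exist. -/
theorem exists_tendsto_frequency {A : Type*} [Fintype A] [DecidableEq A] {ζ : A → FreeMonoid A}
    (hζ : IsExpanding ζ) (hreg : ∀ a b, HasRegularGrowth fun t => (incidence ζ ^ t) b a)
    {w : FreeMonoid A} (hw : w ≠ 1) (a : A) :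
    ∃ f : ℝ, Tendsto (fun t : ℕ => (occurrences w (power ζ t a) : ℝ) /
      ((power ζ t a).length : ℝ)) atTop (𝓝 f) := by
  obtain ⟨k, hk, hexp⟩ := hζ
  refine exists_tendsto_of_approx fun ε hε => ?_
  -- Blocks `ζ^(k * j)(b)` have length at least `2 ^ j`, so this `j` makes the boundary error at
  -- most `ε` times the total length.
  obtain ⟨j, hj⟩ := exists_nat_gt ((w.length : ℝ) / ε)
  have hj2 : (w.length : ℝ) ≤ ε * 2 ^ j := by
    rw [div_lt_iff₀ hε] at hj
    have : (j : ℝ) ≤ 2 ^ j := by exact_mod_cast Nat.lt_two_pow_self.le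
    nlinarith
  set m := k * j with hm
  have hsum : ∀ (g : A → ℕ) (t : ℕ), (((power ζ t a).toList.map g).sum : ℝ) =
      ∑ b, (g b : ℝ) * (incidence ζ ^ t) b a := by
    intro g t
    rw [← incidence_power, sum_map_eq_sum_count]
    simp [incidence]
  have hregsum : ∀ g : A → ℕ, HasRegularGrowth fun t =>
      (((power ζ t a).toList.map g).sum : ℝ) := by
    intro g
    simp only [hsum]
    exact HasRegularGrowth.sum _ fun b _ => (hreg a b).const_mul (Nat.cast_nonneg _)
  have hlen : ∀ t, (power ζ (t + m) a).length =
      ((power ζ t a).toList.map fun b => (power ζ m b).length).sum := fun t => by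
    rw [add_comm t m, power_add, length_extend]
  have hexp' : ∀ b, 2 ^ j ≤ (power ζ m b).length := fun b => by
    rw [hm, ← power_power]
    exact pow_le_length_power hexp j b
  obtain ⟨f, hf⟩ := (hregsum fun b => occurrences w (power ζ m b)).exists_tendsto_div
    (hregsum fun b => (power ζ m b).length) fun t => by
      exact_mod_cast List.sum_le_sum fun b _ => occurrences_le_length hw _
  refine ⟨m, _, f, hf, fun t => ?_⟩
  rw [← hlen t, ← sub_div, abs_div, Nat.abs_cast]
  refine div_le_of_le_mul₀ (Nat.cast_nonneg _) hε.le ?_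
  have h1 := abs_occurrences_extend_sub_le hw (power ζ m) (power ζ t a)
  rw [← power_add, add_comm m t] at h1
  have h2 : ((2 ^ j * (power ζ t a).length : ℕ) : ℝ) ≤ (power ζ (t + m) a).length := by
    rw [add_comm t m, power_add]
    exact_mod_cast mul_length_le_length_extend hexp' _
  push_cast at h2
  calc _ ≤ _ := h1
    _ ≤ ε * 2 ^ j * (power ζ t a).length := mul_le_mul_of_nonneg_right hj2 (Nat.cast_nonneg _)
    _ ≤ _ := by rw [mul_assoc]; exact mul_le_mul_of_nonneg_left h2 hε.le

end Substitution

theorem theorem1p2 {A : Type*} [Finite A] [DecidableEq A] (ξ : A → FreeMonoid A)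
    (hξ : Substitution.IsExpanding ξ) :
    ∃ (s : ℕ) (ζ : A → FreeMonoid A), 1 ≤ s ∧ ζ = Substitution.power ξ s ∧
      ∀ (w : FreeMonoid A), w ≠ 1 → ∀ a : A, ∃ f : ℝ,
        Tendsto
          (fun t : ℕ => (Substitution.occurrences w (Substitution.power ζ t a) : ℝ) /
            ((Substitution.power ζ t a).length : ℝ))
          atTop (𝓝 f) := by
  have := Fintype.ofFinite A
  obtain ⟨s, hs, hreg⟩ := exists_pow_hasRegularGrowth (M := Substitution.incidence ξ)
    fun _ _ => Nat.cast_nonneg _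
  refine ⟨s, _, hs, rfl, fun w hw a => ?_⟩
  refine Substitution.exists_tendsto_frequency (hξ.power hs) (fun a b => ?_) hw a
  rw [Substitution.incidence_power]
  exact hreg b a
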